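/- Let $k$ be an algebraically closed field of characteristic $0$. Let $R=k[X,Y,Z,W]$ act on $\mathcal D=k[x,y,z,w]$ by letting $X,Y,Z,W$ act as $\partial/\partial x,\partial/\partial y,\partial/\partial z,\partial/\partial w$, and for a subspace $\mathcal W\subseteq\mathcal D$ let $\operatorname{Ann}_R(\mathcal W)=\{F\in R: F*f=0 \text{ for all } f\in\mathcal W\}$. For a homogeneous ideal $I$ of $R$ containing no nonzero forms of degree $\le 1$, the algebra $A=R/I$ is called a level algebra of codimension $4$, socle degree $j$ and type $t$ if $A$ is finite-dimensional over $k$, $j$ is the largest integer with $A_j\ne 0$, the socle $\{u\in A: uA_1=0\}$ equals $A_j$, and $\dim_k A_j=t$. For integers $a,b\ge 1$ and $d\ge 0$, let $m_P(d)$ be the number of monomials of degree $d$ in $x,y,z,w$ whose exponent of $x$ is at most $a-1$ and whose exponent of $y$ is at most $b-1$. The family $G_1(a,b,i,s)$ is defined for integers $b\ge a\ge 2$, $i\ge ab+1$, $s\ge1$ with $s\,m_P(ab-3)\ge m_P(i+3)$. Put $j=i+ab$. The members of the family are the algebras $$R/\operatorname{Ann}_R(\mathcal E(C)+\mathcal F(C')),\qquad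 \mathcal E(C)=\langle f_1,\dots,f_s\rangle,\quad \mathcal F(C')=\langle g\rangle,$$ where $f_1,\dots,f_s$ are linear combinations of the monomials of degree $j$ with exponent of $x$ at most $a-1$ and exponent of $y$ at most $b-1$, $g\in k[x,y,z]_j$, and $C\in k^{s\,m_P(j)}$, $C'\in k^{\binom{j+2}{2}}$ are the vectors of coefficients of the $f_l$ and of $g$. We say that $G_1(a,b,i,s)$ has type $t$ if for general $(C,C')$, that is, for all $(C,C')$ in some dense Zariski-open subset of the affine space of coefficients, the corresponding member is a level algebra of codimension $4$, socle degree $j$ and type $t$. **Theorem.** (i) For fixed $b\ge a\ge2$ and $i\ge ab+1$, the smallest possible type in the families $G_1(a,b,i,s)$ is $1+s$ with $$s=\left\lceil\frac{2i-a-b+10}{2ab-a-b-2}\right\rceil ,$$ and it is achieved by this (permitted) value of $s$. (ii) For fixed $b\ge a\ge 2$, the smallest possible type in the families $G_1(a,b,i,s)$ is $1+s$ with $$s=\left\lceil\frac{2ab-a-b+12}{2ab-a-b-2}\right\rceil ,$$ and it is achieved by taking $i=ab+1$ and this (permitted) value of $s$. With these choices of $i$ and $s$, the type is $3$ if and only if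 either $a\ge3,\ b\ge4$ or $a\ge2,\ b\ge6$; and the minimal pairs $(a,b)$ (in the componentwise order, among pairs with $b\ge a\ge2$) for which the type is $4$ are exactly $(2,4)$ and $(3,3)$. (iii) For all permitted $a,b,i,s$, the family $G_1(a,b,i,s)$ has a type, and this type is at least $3$. -/

import Mathlib

open MvPolynomial

namespace LevelAlg

/-! ## Polynomials acting as differential operators -/

section Action

variable {k : Type*} [Field k] {r : ℕ}

variable (k) in
/-- `∂/∂x_i` as a linear operator. -/
noncomputable def dOp (i : Fin r) : Module.End k (MvPolynomial (Fin r) k) :=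
  (pderiv i : Derivation k (MvPolynomial (Fin r) k) (MvPolynomial (Fin r) k)).toLinearMap

theorem dOp_apply (i : Fin r) (f : MvPolynomial (Fin r) k) : dOp k i f = pderiv i f := rfl

theorem dOp_commute (i j : Fin r) : Commute (dOp k i) (dOp k j) := by
  have h : ⁅(pderiv i : Derivation k (MvPolynomial (Fin r) k) (MvPolynomial (Fin r) k)),
      (pderiv j : Derivation k (MvPolynomial (Fin r) k) (MvPolynomial (Fin r) k))⁆ = 0 := by
    refine MvPolynomial.derivation_ext fun l => ?_
    simp only [Derivation.commutator_apply, pderiv_X, Derivation.coe_zero, Pi.zero_apply]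
    rcases eq_or_ne l i with rfl | h1 <;> rcases eq_or_ne l j with rfl | h2 <;>
      simp_all
  refine LinearMap.ext fun f => ?_
  have h2 := congrArg
    (fun D : Derivation k (MvPolynomial (Fin r) k) (MvPolynomial (Fin r) k) => D f) h
  simpa [Derivation.commutator_apply, sub_eq_zero, dOp_apply] using h2

theorem dOp_pow_pairwise (E E' : Fin r →₀ ℕ) :
    ((Finset.univ : Finset (Fin r)) : Set (Fin r)).Pairwise
      fun i j => Commute (dOp k i ^ E i) (dOp k j ^ E' j) :=
  fun i _ j _ _ => (dOp_commute i j).pow_pow _ _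

variable (k) in
/-- The partial derivative operator attached to a multi-index `E`: the composite of the
(pairwise commuting) operators `(∂/∂x_i)^(E i)`. -/
noncomputable def partialOp (E : Fin r →₀ ℕ) : Module.End k (MvPolynomial (Fin r) k) :=
  Finset.univ.noncommProd (fun i => dOp k i ^ E i) (dOp_pow_pairwise E E)

theorem partialOp_zero : partialOp k (0 : Fin r →₀ ℕ) = 1 := by
  unfold partialOp
  rw [Finset.noncommProd_eq_pow_card _ _ _ (1 : Module.End k _) (by simp)]
  simp

theorem partialOp_add (E E' : Fin r →₀ ℕ) :
    partialOp k (E + E') = partialOp k E * partialOp k E' := by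
  unfold partialOp
  rw [← Finset.noncommProd_mul_distrib _ _ _ _ (dOp_pow_pairwise E' E)]
  exact Finset.noncommProd_congr rfl (fun i _ => by simp [pow_add]) _

variable (k r) in
/-- The action `F * f` of `R = k[X_1, …, X_r]` on `𝒟 = k[x_1, …, x_r]` by differential operators,
as an algebra homomorphism `R → End_k(𝒟)`: the monomial `X^E` acts as `partialOp k E`. -/
noncomputable def diffAction :
    MvPolynomial (Fin r) k →ₐ[k] Module.End k (MvPolynomial (Fin r) k) :=
  AddMonoidAlgebra.lift k (Module.End k (MvPolynomial (Fin r) k)) (Fin r →₀ ℕ)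
    { toFun := fun E => partialOp k E.toAdd
      map_one' := partialOp_zero
      map_mul' := fun E E' => partialOp_add E.toAdd E'.toAdd }

theorem diffAction_monomial (E : Fin r →₀ ℕ) (c : k) :
    diffAction k r (monomial E c) = c • partialOp k E :=
  AddMonoidAlgebra.lift_single _ _ _

theorem diffAction_X (i : Fin r) (f : MvPolynomial (Fin r) k) :
    diffAction k r (X i) f = pderiv i f := by
  have h : diffAction k r (X i) = partialOp k (Finsupp.single i 1) := by
    rw [X, diffAction_monomial, one_smul]
  have h2 := Finset.mul_noncommProd_erase _ (Finset.mem_univ i) _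
    (dOp_pow_pairwise (k := k) (Finsupp.single i 1) (Finsupp.single i 1))
  have h3 := Finset.noncommProd_eq_pow_card (Finset.univ.erase i)
    (fun l => dOp k l ^ Finsupp.single i 1 l)
    (fun x hx y hy h => (dOp_commute x y).pow_pow _ _) (1 : Module.End k _)
    (fun l hl => by simp [Finset.ne_of_mem_erase hl])
  rw [h, partialOp, ← h2]
  erw [h3]
  simp [dOp_apply]

/-- `Ann_R(𝒲)`, the ideal of all `F ∈ R` with `F * f = 0` for every `f ∈ 𝒲`. -/
noncomputable def annIdeal (W : Submodule k (MvPolynomial (Fin r) k)) :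
    Ideal (MvPolynomial (Fin r) k) where
  carrier := {F | ∀ f ∈ W, diffAction k r F f = 0}
  zero_mem' := by intro f _; simp
  add_mem' := by
    intro F G hF hG f hf
    simp [hF f hf, hG f hf]
  smul_mem' := by
    intro F G hG f hf
    rw [smul_eq_mul, map_mul, Module.End.mul_apply, hG f hf, map_zero]

end Action

/-! ## Level algebras -/

section Level

variable {k : Type*} [Field k] {r : ℕ}

/-- The degree-`d` piece `A_d = R_d / I_d` of `A = R / I`, as a subspace of `A`. -/
noncomputable def gradedPiece (I : Ideal (MvPolynomial (Fin r) k)) (d : ℕ) :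
    Submodule k (MvPolynomial (Fin r) k ⧸ I) :=
  (homogeneousSubmodule (Fin r) k d).map (Ideal.Quotient.mkₐ k I).toLinearMap

/-- The socle of `A = R / I`: the annihilator in `A` of the linear part `A_1`. -/
noncomputable def socle (I : Ideal (MvPolynomial (Fin r) k)) :
    Submodule k (MvPolynomial (Fin r) k ⧸ I) where
  carrier := {x | ∀ y ∈ gradedPiece I 1, x * y = 0}
  zero_mem' := by intro y _; simp
  add_mem' := by
    intro x x' hx hx' y hy
    simp [add_mul, hx y hy, hx' y hy]
  smul_mem' := by
    intro c x hx y hy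
    rw [smul_mul_assoc, hx y hy, smul_zero]

/-- `A = R / I` is a level algebra of codimension `r` (the number of variables), socle degree `j`
and type `t`. -/
structure IsLevelAlgebra (I : Ideal (MvPolynomial (Fin r) k)) (j t : ℕ) : Prop where
  /-- `I` is a homogeneous ideal -/
  homogeneous : ∀ F ∈ I, ∀ d, homogeneousComponent d F ∈ I
  /-- `I` contains no nonzero constants or linear forms, so `A` has codimension `r` -/
  codimension : ∀ d ≤ 1, ∀ F ∈ homogeneousSubmodule (Fin r) k d, F ∈ I → F = 0
  /-- `A` is Artinian -/
  artinian : Module.Finite k (MvPolynomial (Fin r) k ⧸ I)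
  /-- `j` is the largest degree in which `A` is nonzero -/
  top_ne_bot : gradedPiece I j ≠ ⊥
  eq_bot_of_lt : ∀ d, j < d → gradedPiece I d = ⊥
  /-- the socle is concentrated in degree `j` -/
  socle_eq : socle I = gradedPiece I j
  /-- the type is the dimension of the top piece -/
  type_eq : Module.finrank k (gradedPiece I j) = t

end Level

/-! ## General points of an affine space -/

/-- Zariski-open subsets of the affine space `k^ι`: complements of zero sets of families of
polynomials. -/
def IsZariskiOpen {k ι : Type*} [Field k] (U : Set (ι → k)) : Prop :=
  ∃ S : Set (MvPolynomial ι k), U = {x | ∀ p ∈ S, eval x p = 0}ᶜ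

/-- `P` holds for general `x ∈ k^ι`: it holds on some dense Zariski-open subset. -/
def ForGeneral {k ι : Type*} [Field k] (P : (ι → k) → Prop) : Prop :=
  ∃ U : Set (ι → k), IsZariskiOpen U ∧
    (∀ V : Set (ι → k), IsZariskiOpen V → V.Nonempty → (U ∩ V).Nonempty) ∧ ∀ x ∈ U, P x

/-! ## Families of subspaces spanned by constrained forms -/

/-- `ℳ_Q(d)`: multi-indices `I` of dimension `r` and degree `d` constrained by
`Q = (Q_1, …, Q_n)`, that is, with `I_l ≤ Q_l` for the first `n` coordinates. -/
def constrained {r n : ℕ} (h : n ≤ r) (Q : Fin n → ℕ) (d : ℕ) : Finset (Fin r →₀ ℕ) :=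
  ((Finset.univ : Finset (Fin r)).finsuppAntidiag d).filter
    (fun I => ∀ l : Fin n, I (Fin.castLE h l) ≤ Q l)

/-- The subspace `⟨f_1, …, f_s⟩` of `𝒟`, where `f_l = ∑_{J ∈ M} c_{l,J} x^J` has the
coefficients prescribed by the point `C = (c_{l,J})`. -/
noncomputable def spanForms {k : Type*} [Field k] {r s : ℕ} {M : Finset (Fin r →₀ ℕ)}
    (C : Fin s × M → k) : Submodule k (MvPolynomial (Fin r) k) :=
  Submodule.span k (Set.range fun l : Fin s => ∑ J : M, monomial (J : Fin r →₀ ℕ) (C (l, J)))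

/-- Row indices `(E, l)` of the `e`-th cropped matrix of a family of `s` forms constrained
by `P` (the matrix of the coefficients of `x^D` in `X^E * f_l`). -/
abbrev CroppedRow {r n : ℕ} (h : n ≤ r) (P : Fin n → ℕ) (s e : ℕ) : Type :=
  constrained h P e × Fin s

/-- Column indices `D`, of degree `d = j - e`, of the same matrix. -/
abbrev CroppedCol {r n : ℕ} (h : n ≤ r) (P : Fin n → ℕ) (d : ℕ) : Type :=
  constrained h P d

/-! ## The family `G₁(a,b,i,s)` -/

section G1

/-- The socle degree `j = i + ab`. -/
def g1J (a b i : ℕ) : ℕ := i + a * b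

/-- `ℳ_P(d)` for the constraint `P = (a-1, b-1)`, in four variables. -/
def g1MP (a b d : ℕ) : Finset (Fin 4 →₀ ℕ) :=
  constrained (n := 2) (by norm_num) ![a - 1, b - 1] d

/-- `ℳ_Q(d)` for the constraint `Q = (j, j, j, 0)`, in four variables. -/
def g1MQ (j d : ℕ) : Finset (Fin 4 →₀ ℕ) :=
  constrained (n := 4) le_rfl ![j, j, j, 0] d

/-- `s` is `h_ℰ`-sufficient: the `(j - i_f)`-th cropped matrix of `ℰ`, where `i_f = i + 3`, has at
least as many rows as columns. -/
def G1Sufficient (a b i s : ℕ) : Prop :=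
  Fintype.card (CroppedCol (r := 4) (n := 2) (by norm_num) ![a - 1, b - 1] (i + 3)) ≤
    Fintype.card
      (CroppedRow (r := 4) (n := 2) (by norm_num) ![a - 1, b - 1] s (g1J a b i - (i + 3)))

/-- The requirements on the parameters of `G₁(a,b,i,s)`. -/
structure G1Admissible (a b i s : ℕ) : Prop where
  two_le : 2 ≤ a
  le : a ≤ b
  le_i : a * b + 1 ≤ i
  s_pos : 0 < s
  sufficient : G1Sufficient a b i s

/-- Index set of the coefficients `(C, C')` of the generators `f_1, …, f_s` of `ℰ` and of the
single generator `g_1` of `ℱ`. -/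
abbrev G1Param (a b i s : ℕ) : Type :=
  (Fin s × g1MP a b (g1J a b i)) ⊕ (Fin 1 × g1MQ (g1J a b i) (g1J a b i))

variable {k : Type*} [Field k]

/-- The ideal `Ann_R(ℰ(C) + ℱ(C'))` defining the member of the family at the point
`z = (C, C')`. -/
noncomputable def g1Ideal (a b i s : ℕ) (z : G1Param a b i s → k) :
    Ideal (MvPolynomial (Fin 4) k) :=
  annIdeal (spanForms (fun p => z (Sum.inl p)) ⊔ spanForms (fun p => z (Sum.inr p)))

variable (k) in
/-- For general `(C, C')`, the algebra `G₁(a,b,i,s)(C, C')` is a level algebra of codimension `4`,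
socle degree `j` and type `t`. -/
def G1HasType (a b i s t : ℕ) : Prop :=
  ForGeneral fun z : G1Param a b i s → k => IsLevelAlgebra (g1Ideal a b i s z) (g1J a b i) t

end G1

end LevelAlg

/-! By Macaulay duality, a nonzero space `W` of forms of degree `j` that no nonzero linear form
annihilates defines a level algebra of socle degree `j` and type `dim W`
(`isLevelAlgebra_annIdeal`). So the type of a general member is the dimension of `ℰ + ℱ`. The
coefficients of the `f_l` are independent variables, so a maximal minor of their matrix is
generically nonzero and `dim ℰ = min s m_P(j)`. The monomial `x^j` is forbidden in `ℰ` but occurs in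
a general `g`, so `ℱ` adds exactly one. A single general `f_l` already has no linear annihilator.
Hence the type is `1 + min s m_P(j)` (`g1HasType`); the sufficiency condition only decides which `s`
are permitted.

The rest is counting. For `d ≥ a + b - 3` one has `2 m_P(d) = ab(2d + 4 - a - b)`, which turns
sufficiency into `2i - a - b + 10 ≤ s(2ab - a - b - 2)` (`g1Sufficient_iff`). The least such `s` is
a ceiling, is weakly increasing in `i`, is at least `2`, and never exceeds `m_P(j)`. Thus the
minimum in the type formula never pushes the type below the value at the least `s`
(`isLeast_g1HasType`). -/

namespace LevelAlg

/-! ### Coefficients of `F * f` for homogeneous `f`. -/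

section Pairing

variable {k : Type*} [Field k] {r : ℕ}

/-- The constant is a product of positive integers, hence nonzero in characteristic `0`. It depends
on `D` and `E` but not on `f`, which is what makes the pairing of forms with operators
nondegenerate. -/
theorem exists_coeff_partialOp [CharZero k] (E : Fin r →₀ ℕ) :
    ∀ D : Fin r →₀ ℕ, ∃ c : k, c ≠ 0 ∧ ∀ f : MvPolynomial (Fin r) k,
      coeff D (partialOp k E f) = c * coeff (D + E) f := by
  induction E using Finsupp.induction_linear with
  | zero => exact fun D => ⟨1, one_ne_zero, fun f => by simp [partialOp_zero]⟩
  | add E E' hE hE' =>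
    intro D
    obtain ⟨c, hc, h⟩ := hE D
    obtain ⟨c', hc', h'⟩ := hE' (D + E)
    exact ⟨c * c', mul_ne_zero hc hc', fun f => by
      rw [partialOp_add, Module.End.mul_apply, h, h', mul_assoc, add_assoc]⟩
  | single i n =>
    induction n with
    | zero => exact fun D => ⟨1, one_ne_zero, fun f => by simp [partialOp_zero]⟩
    | succ n ih =>
      intro D
      obtain ⟨c, hc, h⟩ := ih D
      refine ⟨c * (((D + Finsupp.single i n) i : k) + 1),
        mul_ne_zero hc (Nat.cast_add_one_ne_zero _), fun f => ?_⟩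
      have h1 : partialOp k (Finsupp.single i 1) f = pderiv i f := by
        rw [← diffAction_X, X, diffAction_monomial, one_smul]
      rw [Finsupp.single_add, partialOp_add, Module.End.mul_apply, h, h1, coeff_pderiv, add_assoc]
      ring

theorem coeff_diffAction_monomial_of_ne [CharZero k] {f : MvPolynomial (Fin r) k} {j : ℕ}
    (hf : f.IsHomogeneous j) (E D : Fin r →₀ ℕ) (c : k) (h : D.degree + E.degree ≠ j) :
    coeff D (diffAction k r (monomial E c) f) = 0 := by
  obtain ⟨α, -, hα⟩ := exists_coeff_partialOp (k := k) E D
  rw [diffAction_monomial, LinearMap.smul_apply, coeff_smul, hα,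
    hf.coeff_eq_zero (by simpa using h), mul_zero, smul_zero]

theorem coeff_diffAction_of_ne [CharZero k] {f F : MvPolynomial (Fin r) k} {j d : ℕ}
    (hf : f.IsHomogeneous j) (hF : F.IsHomogeneous d) (D : Fin r →₀ ℕ) (h : D.degree + d ≠ j) :
    coeff D (diffAction k r F f) = 0 := by
  rw [F.as_sum, map_sum, LinearMap.sum_apply, coeff_sum]
  refine Finset.sum_eq_zero fun E hE => coeff_diffAction_monomial_of_ne hf E D _ ?_
  have : E.degree = d := by
    by_contra h'
    exact (mem_support_iff.mp hE) (hF.coeff_eq_zero h')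
  rwa [this]

theorem coeff_diffAction_homogeneousComponent [CharZero k] {f : MvPolynomial (Fin r) k} {j d : ℕ}
    (hf : f.IsHomogeneous j) (F : MvPolynomial (Fin r) k) (D : Fin r →₀ ℕ)
    (h : D.degree + d = j) :
    coeff D (diffAction k r (homogeneousComponent d F) f) = coeff D (diffAction k r F f) := by
  conv_rhs => rw [← sum_homogeneousComponent F, map_sum, LinearMap.sum_apply, coeff_sum]
  rw [Finset.sum_eq_single d]
  · intro e _ he
    exact coeff_diffAction_of_ne hf (homogeneousComponent_isHomogeneous e F) D (by omega)
  · intro hd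
    rw [homogeneousComponent_eq_zero _ _ (by simpa using hd)]
    simp

theorem diffAction_homogeneousComponent_eq_zero [CharZero k] {f : MvPolynomial (Fin r) k} {j : ℕ}
    (hf : f.IsHomogeneous j) {F : MvPolynomial (Fin r) k} (hF : diffAction k r F f = 0) (d : ℕ) :
    diffAction k r (homogeneousComponent d F) f = 0 := by
  ext D
  by_cases h : D.degree + d = j
  · rw [coeff_diffAction_homogeneousComponent hf F D h, hF]
  · rw [coeff_diffAction_of_ne hf (homogeneousComponent_isHomogeneous d F) D h, coeff_zero]

theorem diffAction_eq_zero_of_lt [CharZero k] {f F : MvPolynomial (Fin r) k} {j d : ℕ}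
    (hf : f.IsHomogeneous j) (hF : F.IsHomogeneous d) (h : j < d) : diffAction k r F f = 0 := by
  ext D
  rw [coeff_diffAction_of_ne hf hF D (by omega), coeff_zero]

theorem diffAction_eq_C [CharZero k] {f F : MvPolynomial (Fin r) k} {j : ℕ}
    (hf : f.IsHomogeneous j) (hF : F.IsHomogeneous j) :
    diffAction k r F f = C (coeff 0 (diffAction k r F f)) := by
  ext D
  rw [coeff_C]
  split_ifs with h
  · rw [h]
  · refine coeff_diffAction_of_ne hf hF D ?_
    have : D.degree ≠ 0 := fun h' => h ((Finsupp.degree_eq_zero_iff D).mp h').symm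
    omega

theorem exists_diffAction_ne_zero [CharZero k] {f : MvPolynomial (Fin r) k} {j : ℕ}
    (hf : f.IsHomogeneous j) (h0 : f ≠ 0) :
    ∃ F : MvPolynomial (Fin r) k, F.IsHomogeneous j ∧ coeff 0 (diffAction k r F f) ≠ 0 := by
  obtain ⟨E, hE⟩ := ne_zero_iff.mp h0
  obtain ⟨c, hc, h⟩ := exists_coeff_partialOp (k := k) E 0
  refine ⟨monomial E 1, isHomogeneous_monomial _ ?_, ?_⟩
  · by_contra h'
    exact hE (hf.coeff_eq_zero h')
  · rw [diffAction_monomial, one_smul, h, zero_add]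
    exact mul_ne_zero hc hE

theorem eq_C_of_pderiv_eq_zero [CharZero k] {f : MvPolynomial (Fin r) k}
    (h : ∀ i, pderiv i f = 0) : f = C (coeff 0 f) := by
  ext D
  rw [coeff_C]
  split_ifs with hD
  · rw [hD]
  · obtain ⟨i, hi⟩ := Finsupp.ne_iff.mp (Ne.symm hD)
    have h1 : D = (D - Finsupp.single i 1) + Finsupp.single i 1 :=
      (tsub_add_cancel_of_le (Finsupp.single_le_iff.mpr (Nat.one_le_iff_ne_zero.mpr hi))).symm
    have h2 := coeff_pderiv (i := i) f (D - Finsupp.single i 1)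
    rw [h i, coeff_zero, ← h1] at h2
    exact (mul_eq_zero.mp h2.symm).resolve_right (Nat.cast_add_one_ne_zero _)

end Pairing

/-! ### Macaulay duality: level algebras from spaces of forms. -/

section Level

variable {k : Type*} [Field k] {r : ℕ}

theorem mem_annIdeal {W : Submodule k (MvPolynomial (Fin r) k)} {F : MvPolynomial (Fin r) k} :
    F ∈ annIdeal W ↔ ∀ f ∈ W, diffAction k r F f = 0 := Iff.rfl

theorem mem_gradedPiece {I : Ideal (MvPolynomial (Fin r) k)} {d : ℕ}
    {x : MvPolynomial (Fin r) k ⧸ I} :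
    x ∈ gradedPiece I d ↔ ∃ F : MvPolynomial (Fin r) k, F.IsHomogeneous d ∧
      Ideal.Quotient.mk I F = x := Iff.rfl

theorem exists_eq_sum_X {F : MvPolynomial (Fin r) k} (hF : F ∈ homogeneousSubmodule (Fin r) k 1) :
    ∃ c : Fin r → k, F = ∑ i, c i • X i := by
  rw [homogeneousSubmodule_one_eq_span_X, Submodule.mem_span_range_iff_exists_fun] at hF
  obtain ⟨c, hc⟩ := hF
  exact ⟨c, hc.symm⟩

theorem coeff_diffAction_sum_X (c : Fin r → k) (f : MvPolynomial (Fin r) k) (D : Fin r →₀ ℕ) :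
    coeff D (diffAction k r (∑ i, c i • X i) f) =
      ∑ i, c i * (coeff (D + Finsupp.single i 1) f * (D i + 1)) := by
  simp [LinearMap.sum_apply, coeff_sum, diffAction_X, coeff_pderiv]

variable (k r) in
/-- The pairing `(f, F) ↦ (F * f)(0)` of `W` with the forms of degree `j`. -/
noncomputable def apolarPairing (W : Submodule k (MvPolynomial (Fin r) k)) (j : ℕ) :
    W →ₗ[k] homogeneousSubmodule (Fin r) k j →ₗ[k] k :=
  LinearMap.mk₂ k (fun f F => coeff 0 (diffAction k r F.1 f.1))
    (fun f f' F => by simp) (fun c f F => by simp) (fun f F F' => by simp) (fun c f F => by simp)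

variable [CharZero k] {W : Submodule k (MvPolynomial (Fin r) k)} {j : ℕ}

theorem mem_annIdeal_of_lt (hW : W ≤ homogeneousSubmodule (Fin r) k j)
    {F : MvPolynomial (Fin r) k} {d : ℕ} (hF : F.IsHomogeneous d) (h : j < d) : F ∈ annIdeal W :=
  fun _ hf => diffAction_eq_zero_of_lt (hW hf) hF h

theorem apolarPairing_injective (hW : W ≤ homogeneousSubmodule (Fin r) k j) :
    Function.Injective (apolarPairing k r W j) := by
  rw [injective_iff_map_eq_zero]
  intro f hf
  by_contra h0
  obtain ⟨F, hF, hne⟩ := exists_diffAction_ne_zero (hW f.2) (by simpa using h0)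
  exact hne (LinearMap.congr_fun hf ⟨F, hF⟩)

/-- The apolar pairing embeds `W` in the dual of `R_j`; dually `R_j` maps onto the dual of `W`, with
kernel the degree `j` part of the annihilator. -/
theorem finrank_gradedPiece_annIdeal (hW : W ≤ homogeneousSubmodule (Fin r) k j) :
    Module.finrank k (gradedPiece (annIdeal W) j) = Module.finrank k W := by
  have : Module.Finite k (homogeneousSubmodule (Fin r) k j) :=
    Module.Finite.iff_fg.mpr (homogeneousSubmodule_fg (Fin r) k j)
  have : Module.Finite k W := Module.Finite.of_injective
    (Submodule.inclusion hW) (Submodule.inclusion_injective hW)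
  set ψ := (apolarPairing k r W j).flip with hψ
  set π := (Ideal.Quotient.mkₐ k (annIdeal W)).toLinearMap.comp
    (homogeneousSubmodule (Fin r) k j).subtype with hπ
  have hsurj : Function.Surjective ψ := by
    -- `ψ` is the transpose of an injection, read through the biduality isomorphism of `R_j`, hence
    -- surjective.
    have h1 : ψ = (apolarPairing k r W j).dualMap ∘ₗ
        (Module.evalEquiv k (homogeneousSubmodule (Fin r) k j)).toLinearMap := by
      ext F f
      rfl
    rw [h1]
    exact (LinearMap.dualMap_surjective_of_injective (apolarPairing_injective hW)).comp
      (Module.evalEquiv k _).surjective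
  -- When `F` and `f` both have degree `j`, `F * f` is a constant, so its vanishing is that of its
  -- constant coefficient.
  have hker : LinearMap.ker π = LinearMap.ker ψ := by
    ext F
    have h2 : F ∈ LinearMap.ker π ↔ F.1 ∈ annIdeal W := by
      rw [LinearMap.mem_ker]
      exact Ideal.Quotient.eq_zero_iff_mem
    rw [h2, LinearMap.mem_ker, mem_annIdeal]
    constructor
    · intro h
      ext f
      change coeff 0 (diffAction k r F.1 f.1) = 0
      rw [h f.1 f.2, coeff_zero]
    · intro h f hf
      rw [diffAction_eq_C (hW hf) F.2]
      have h3 : coeff 0 (diffAction k r F.1 f) = 0 := LinearMap.congr_fun h ⟨f, hf⟩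
      rw [h3, C_0]
  have hrange : gradedPiece (annIdeal W) j = LinearMap.range π := by
    rw [hπ, LinearMap.range_comp, Submodule.range_subtype]
    rfl
  have e1 := LinearMap.finrank_range_add_finrank_ker π
  have e2 := LinearMap.finrank_range_add_finrank_ker ψ
  rw [LinearMap.range_eq_top.mpr hsurj, finrank_top] at e2
  have e3 : Module.finrank k (W →ₗ[k] k) = Module.finrank k W := Subspace.dual_finrank_eq
  rw [hrange, ← e3]
  rw [hker] at e1
  omega

theorem finite_quotient_annIdeal (hW : W ≤ homogeneousSubmodule (Fin r) k j) :
    Module.Finite k (MvPolynomial (Fin r) k ⧸ annIdeal W) := by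
  refine Module.Finite.of_surjective ((Ideal.Quotient.mkₐ k (annIdeal W)).toLinearMap.comp
    (restrictTotalDegree (Fin r) k j).subtype) fun x => ?_
  obtain ⟨F, rfl⟩ := Ideal.Quotient.mk_surjective x
  refine ⟨⟨∑ d ∈ Finset.range (j + 1), homogeneousComponent d F, ?_⟩, ?_⟩
  · refine Submodule.sum_mem _ fun d hd => ?_
    rw [mem_restrictTotalDegree]
    exact (homogeneousComponent_isHomogeneous d F).totalDegree_le.trans
      (Nat.lt_succ_iff.mp (Finset.mem_range.mp hd))
  · change Ideal.Quotient.mk _ (∑ d ∈ Finset.range (j + 1), homogeneousComponent d F) =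
      Ideal.Quotient.mk _ F
    rw [Ideal.Quotient.eq]
    intro f hf
    ext D
    simp only [map_sub, map_sum, LinearMap.sub_apply, LinearMap.sum_apply, coeff_sub,
      coeff_sum, coeff_zero]
    by_cases hD : D.degree ≤ j
    -- Only the component of `F` of degree `j - deg D` can contribute to the coefficient at `D`, and
    -- the truncation keeps it.
    · rw [Finset.sum_eq_single_of_mem (j - D.degree) (by simp)
        fun e _ he => coeff_diffAction_of_ne (hW hf) (homogeneousComponent_isHomogeneous e F) D
          (by omega),
        coeff_diffAction_homogeneousComponent (hW hf) F D (by omega), sub_self]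
    · rw [Finset.sum_eq_zero fun e _ => coeff_diffAction_of_ne (hW hf)
        (homogeneousComponent_isHomogeneous e F) D (by omega), zero_sub, neg_eq_zero]
      conv_lhs => rw [← sum_homogeneousComponent F, map_sum, LinearMap.sum_apply, coeff_sum]
      exact Finset.sum_eq_zero fun e _ => coeff_diffAction_of_ne (hW hf)
        (homogeneousComponent_isHomogeneous e F) D (by omega)

theorem socle_annIdeal (hW : W ≤ homogeneousSubmodule (Fin r) k j) :
    socle (annIdeal W) = gradedPiece (annIdeal W) j := by
  apply le_antisymm
  · intro x hx
    obtain ⟨F, rfl⟩ := Ideal.Quotient.mk_surjective x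
    -- A socle element times each `X i` lies in the annihilator, so every partial derivative of `F *
    -- f` vanishes. Being constant, `F * f` only sees the degree `j` component of `F`.
    have hC : ∀ f ∈ W, diffAction k r F f = C (coeff 0 (diffAction k r F f)) := by
      intro f hf
      refine eq_C_of_pderiv_eq_zero fun i => ?_
      have h1 := hx (Ideal.Quotient.mk _ (X i)) (mem_gradedPiece.mpr ⟨X i, isHomogeneous_X _ _, rfl⟩)
      rw [← map_mul, Ideal.Quotient.eq_zero_iff_mem, mul_comm] at h1
      have h2 := h1 f hf
      rwa [map_mul, Module.End.mul_apply, diffAction_X] at h2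
    refine mem_gradedPiece.mpr ⟨homogeneousComponent j F, homogeneousComponent_isHomogeneous j F, ?_⟩
    rw [Ideal.Quotient.eq]
    intro f hf
    rw [map_sub, LinearMap.sub_apply, sub_eq_zero,
      diffAction_eq_C (hW hf) (homogeneousComponent_isHomogeneous j F),
      coeff_diffAction_homogeneousComponent (hW hf) F 0 (by simp), ← hC f hf]
  · intro x hx y hy
    obtain ⟨F, hF, rfl⟩ := mem_gradedPiece.mp hx
    obtain ⟨G, hG, rfl⟩ := mem_gradedPiece.mp hy
    rw [← map_mul, Ideal.Quotient.eq_zero_iff_mem]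
    exact mem_annIdeal_of_lt hW (hF.mul hG) (by omega)

/-- Macaulay duality: forms of the same degree generate a level algebra. -/
theorem isLevelAlgebra_annIdeal (hW : W ≤ homogeneousSubmodule (Fin r) k j) (h0 : W ≠ ⊥)
    (hlin : ∀ F ∈ homogeneousSubmodule (Fin r) k 1, F ∈ annIdeal W → F = 0) :
    IsLevelAlgebra (annIdeal W) j (Module.finrank k W) where
  homogeneous F hF d f hf := diffAction_homogeneousComponent_eq_zero (hW hf) (hF f hf) d
  codimension d hd F hF hFW := by
    interval_cases d
    · obtain ⟨f, hf, hf0⟩ := W.ne_bot_iff.mp h0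
      have h1 : F = C (coeff 0 F) :=
        totalDegree_eq_zero_iff_eq_C.mp (Nat.le_zero.mp (IsHomogeneous.totalDegree_le hF))
      have h2 := hFW f hf
      rw [h1, C_apply, diffAction_monomial, partialOp_zero, LinearMap.smul_apply,
        Module.End.one_apply] at h2
      rw [h1, (smul_eq_zero.mp h2).resolve_right hf0, C_0]
    · exact hlin F hF hFW
  artinian := finite_quotient_annIdeal hW
  top_ne_bot h := by
    obtain ⟨f, hf, hf0⟩ := W.ne_bot_iff.mp h0
    obtain ⟨F, hF, hne⟩ := exists_diffAction_ne_zero (hW hf) hf0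
    have h1 : Ideal.Quotient.mk (annIdeal W) F ∈ gradedPiece (annIdeal W) j :=
      mem_gradedPiece.mpr ⟨F, hF, rfl⟩
    rw [h, Submodule.mem_bot, Ideal.Quotient.eq_zero_iff_mem] at h1
    exact hne (by rw [h1 f hf, coeff_zero])
  eq_bot_of_lt d hd := by
    rw [eq_bot_iff]
    intro x hx
    obtain ⟨F, hF, rfl⟩ := mem_gradedPiece.mp hx
    exact Ideal.Quotient.eq_zero_iff_mem.mpr (mem_annIdeal_of_lt hW hF hd)
  socle_eq := socle_annIdeal hW
  type_eq := finrank_gradedPiece_annIdeal hW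

end Level

/-! ### Generic conditions on affine space. -/

section General

variable {k ι : Type*} [Field k]

theorem forGeneral_of_ne_zero [Infinite k] {P : (ι → k) → Prop} (p : MvPolynomial ι k)
    (hp : p ≠ 0) (h : ∀ x, eval x p ≠ 0 → P x) : ForGeneral P := by
  refine ⟨{x | ∀ q ∈ ({p} : Set (MvPolynomial ι k)), eval x q = 0}ᶜ, ⟨{p}, rfl⟩, ?_, ?_⟩
  · rintro V ⟨S, rfl⟩ ⟨v, hv⟩
    simp only [Set.mem_compl_iff, Set.mem_ofPred_eq, not_forall] at hv
    obtain ⟨q, hq, hvq⟩ := hv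
    have hq0 : q ≠ 0 := by
      rintro rfl
      exact hvq (map_zero _)
    obtain ⟨x, hx⟩ : ∃ x, eval x (p * q) ≠ 0 := by
      by_contra! hx
      exact mul_ne_zero hp hq0 (MvPolynomial.funext fun x => by rw [hx, map_zero])
    rw [map_mul] at hx
    refine ⟨x, ?_, ?_⟩
    · simpa using left_ne_zero_of_mul hx
    · simp only [Set.mem_compl_iff, Set.mem_ofPred_eq, not_forall]
      exact ⟨q, hq, right_ne_zero_of_mul hx⟩
  · intro x hx
    exact h x (by simpa using hx)

/-- Two dense open sets meet; this makes the type of a family unique. -/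
theorem ForGeneral.exists_and {P Q : (ι → k) → Prop} (hP : ForGeneral P) (hQ : ForGeneral Q) :
    ∃ x, P x ∧ Q x := by
  obtain ⟨U, -, hU, hUP⟩ := hP
  obtain ⟨V, hVo, hV, hVQ⟩ := hQ
  have hne : V.Nonempty := by
    obtain ⟨x, hx, -⟩ := hV Set.univ ⟨{1}, by simp⟩ Set.univ_nonempty
    exact ⟨x, hx⟩
  obtain ⟨x, hxU, hxV⟩ := hU V hVo hne
  exact ⟨x, hUP x hxU, hVQ x hxV⟩

theorem det_X_ne_zero {n : ℕ} (e : Fin n × Fin n → ι) (he : Function.Injective e) :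
    (Matrix.of fun p q => (X (e (p, q)) : MvPolynomial ι k)).det ≠ 0 := by
  have h : (Matrix.of fun p q => (X (e (p, q)) : MvPolynomial ι k)) =
      (rename e).mapMatrix (Matrix.mvPolynomialX (Fin n) (Fin n) k) := by
    ext1 p q
    simp
  rw [h, ← AlgHom.map_det]
  exact (map_ne_zero_iff _ (rename_injective e he)).mpr (Matrix.det_mvPolynomialX_ne_zero _ _)

end General

/-! ### Dimension of the span of forms with prescribed monomials. -/

section Forms

variable {k : Type*} [Field k] {r s : ℕ} {M : Finset (Fin r →₀ ℕ)}

theorem coeff_form (C : Fin s × M → k) (l : Fin s) {D : Fin r →₀ ℕ} (h : D ∈ M) :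
    coeff D (∑ J : M, monomial (J : Fin r →₀ ℕ) (C (l, J))) = C (l, ⟨D, h⟩) := by
  rw [coeff_sum, Finset.sum_eq_single_of_mem ⟨D, h⟩ (Finset.mem_univ _)]
  · simp
  · intro J _ hJ
    rw [coeff_monomial, if_neg fun h' => hJ (Subtype.ext h')]

theorem coeff_form_of_notMem (C : Fin s × M → k) (l : Fin s) {D : Fin r →₀ ℕ} (h : D ∉ M) :
    coeff D (∑ J : M, monomial (J : Fin r →₀ ℕ) (C (l, J))) = 0 := by
  rw [coeff_sum]
  refine Finset.sum_eq_zero fun J _ => ?_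
  rw [coeff_monomial, if_neg]
  rintro rfl
  exact h J.2

theorem form_mem_spanForms (C : Fin s × M → k) (l : Fin s) :
    ∑ J : M, monomial (J : Fin r →₀ ℕ) (C (l, J)) ∈ spanForms C :=
  Submodule.subset_span ⟨l, rfl⟩

instance finite_spanForms (C : Fin s × M → k) : Module.Finite k (spanForms C) :=
  Module.Finite.span_of_finite k (Set.finite_range _)

theorem spanForms_le_homogeneousSubmodule (C : Fin s × M → k) {j : ℕ}
    (hM : ∀ D ∈ M, D.degree = j) : spanForms C ≤ homogeneousSubmodule (Fin r) k j := by
  refine Submodule.span_le.mpr ?_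
  rintro _ ⟨l, rfl⟩
  exact Submodule.sum_mem _ fun J _ => isHomogeneous_monomial _ (hM J J.2)

theorem coeff_eq_zero_of_mem_spanForms {C : Fin s × M → k} {D : Fin r →₀ ℕ} (h : D ∉ M)
    {f : MvPolynomial (Fin r) k} (hf : f ∈ spanForms C) : coeff D f = 0 := by
  have h1 : spanForms C ≤ LinearMap.ker (lcoeff k D) := by
    refine Submodule.span_le.mpr ?_
    rintro _ ⟨l, rfl⟩
    exact coeff_form_of_notMem C l h
  exact h1 hf

theorem finrank_spanForms_le (C : Fin s × M → k) :
    Module.finrank k (spanForms C) ≤ min s M.card := by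
  refine le_min ((finrank_range_le_card _).trans_eq (Fintype.card_fin s)) ?_
  have h1 : spanForms C ≤
      Submodule.span k (Set.range fun J : M => monomial (J : Fin r →₀ ℕ) (1 : k)) := by
    refine Submodule.span_le.mpr ?_
    rintro _ ⟨l, rfl⟩
    refine Submodule.sum_mem _ fun J _ => ?_
    have h2 : monomial (J : Fin r →₀ ℕ) (C (l, J)) =
        C (l, J) • monomial (J : Fin r →₀ ℕ) (1 : k) := by simp [smul_monomial]
    rw [h2]
    exact Submodule.smul_mem _ _ (Submodule.subset_span ⟨J, rfl⟩)
  have := Module.Finite.span_of_finite k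
    (Set.finite_range fun J : M => monomial (J : Fin r →₀ ℕ) (1 : k))
  exact (Submodule.finrank_mono h1).trans
    ((finrank_range_le_card _).trans_eq (Fintype.card_coe M))

/-- A linear relation among the selected forms, read at the selected monomials, lies in the left
kernel of an invertible minor. -/
theorem le_finrank_spanForms (C : Fin s × M → k) {n : ℕ} (e : Fin n → Fin s) (e' : Fin n → M)
    (h : (Matrix.of fun p q => C (e p, e' q)).det ≠ 0) : n ≤ Module.finrank k (spanForms C) := by
  set f : Fin n → MvPolynomial (Fin r) k :=
    fun p => ∑ J : M, monomial (J : Fin r →₀ ℕ) (C (e p, J)) with hf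
  have hli : LinearIndependent k f := by
    rw [Fintype.linearIndependent_iff]
    intro c hc
    refine congrFun (Matrix.eq_zero_of_vecMul_eq_zero h (funext fun q => ?_))
    have h1 := congrArg (coeff (R := k) (e' q : Fin r →₀ ℕ)) hc
    rw [coeff_sum, coeff_zero] at h1
    rw [Pi.zero_apply, ← h1]
    change ∑ p, c p * C (e p, e' q) = _
    refine Finset.sum_congr rfl fun p _ => ?_
    rw [coeff_smul, hf, coeff_form C (e p) (e' q).2]
    rfl
  have h2 : Submodule.span k (Set.range f) ≤ spanForms C := by
    refine Submodule.span_le.mpr ?_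
    rintro _ ⟨p, rfl⟩
    exact form_mem_spanForms C (e p)
  have h3 := finrank_span_eq_card hli
  rw [Fintype.card_fin] at h3
  exact h3.symm.le.trans (Submodule.finrank_mono h2)

/-- The coefficient at `D` vanishes on the first span but not on the generator of the second, so the
two meet trivially. -/
theorem finrank_spanForms_sup {M' : Finset (Fin r →₀ ℕ)} (C : Fin s × M → k)
    (C' : Fin 1 × M' → k) {D : Fin r →₀ ℕ} (hD : D ∉ M) (hD' : D ∈ M')
    (h : C' (0, ⟨D, hD'⟩) ≠ 0) :
    Module.finrank k (spanForms C ⊔ spanForms C' : Submodule k (MvPolynomial (Fin r) k)) =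
      Module.finrank k (spanForms C) + 1 := by
  set g : MvPolynomial (Fin r) k :=
    ∑ J : M', monomial (J : Fin r →₀ ℕ) (C' (0, J)) with hg
  have hgD : coeff D g ≠ 0 := by rwa [hg, coeff_form C' 0 hD']
  have h1 : spanForms C' = Submodule.span k {g} := by
    rw [spanForms, Set.range_unique]
    rfl
  have hinf : spanForms C ⊓ spanForms C' = ⊥ := by
    rw [eq_bot_iff]
    rintro f ⟨hf, hf'⟩
    rw [SetLike.mem_coe, h1] at hf'
    obtain ⟨c, rfl⟩ := Submodule.mem_span_singleton.mp hf'
    have h2 := coeff_eq_zero_of_mem_spanForms hD hf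
    rw [coeff_smul, smul_eq_mul] at h2
    rw [(mul_eq_zero.mp h2).resolve_right hgD, zero_smul]
    exact Submodule.zero_mem _
  have h3 := Submodule.finrank_sup_add_finrank_inf_eq (spanForms C) (spanForms C')
  rw [hinf, finrank_bot, add_zero] at h3
  rw [h3]
  congr 1
  rw [h1]
  refine finrank_span_singleton fun h0 => hgD ?_
  rw [h0, coeff_zero]

end Forms

/-! ### Linear annihilators of one form in four variables. -/

section FourVariables

/-- The exponent of the monomial `x^p y^q z^u w^v`. -/
noncomputable def expVec (p q u v : ℕ) : Fin 4 →₀ ℕ := Finsupp.equivFunOnFinite.symm ![p, q, u, v]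

@[simp] theorem expVec_zero (p q u v : ℕ) : expVec p q u v 0 = p := rfl
@[simp] theorem expVec_one (p q u v : ℕ) : expVec p q u v 1 = q := rfl
@[simp] theorem expVec_two (p q u v : ℕ) : expVec p q u v 2 = u := rfl
@[simp] theorem expVec_three (p q u v : ℕ) : expVec p q u v 3 = v := rfl

theorem expVec_eta (D : Fin 4 →₀ ℕ) : expVec (D 0) (D 1) (D 2) (D 3) = D := by
  ext i
  fin_cases i <;> rfl

theorem expVec_add_single_zero (p q u v : ℕ) :
    expVec p q u v + Finsupp.single 0 1 = expVec (p + 1) q u v := by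
  ext i
  fin_cases i <;> simp [expVec]

theorem expVec_add_single_one (p q u v : ℕ) :
    expVec p q u v + Finsupp.single 1 1 = expVec p (q + 1) u v := by
  ext i
  fin_cases i <;> simp [expVec]

theorem expVec_add_single_two (p q u v : ℕ) :
    expVec p q u v + Finsupp.single 2 1 = expVec p q (u + 1) v := by
  ext i
  fin_cases i <;> simp [expVec]

theorem expVec_add_single_three (p q u v : ℕ) :
    expVec p q u v + Finsupp.single 3 1 = expVec p q u (v + 1) := by
  ext i
  fin_cases i <;> simp [expVec]

theorem mem_g1MP {a b d : ℕ} {D : Fin 4 →₀ ℕ} :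
    D ∈ g1MP a b d ↔ D 0 + D 1 + D 2 + D 3 = d ∧ D 0 ≤ a - 1 ∧ D 1 ≤ b - 1 := by
  simp only [g1MP, constrained, Finset.mem_filter, Finset.mem_finsuppAntidiag,
    Fin.sum_univ_four, Finset.subset_univ, and_true, Fin.forall_fin_two]
  rfl

theorem degree_eq_of_mem_constrained {r n : ℕ} {h : n ≤ r} {Q : Fin n → ℕ} {d : ℕ}
    {D : Fin r →₀ ℕ} (hD : D ∈ constrained h Q d) : D.degree = d := by
  rw [constrained, Finset.mem_filter, Finset.mem_finsuppAntidiag] at hD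
  rw [Finsupp.degree_eq_sum, hD.1.1]

theorem expVec_mem_g1MQ (j : ℕ) : expVec j 0 0 0 ∈ g1MQ j j := by
  simp only [g1MQ, constrained, Finset.mem_filter, Finset.mem_finsuppAntidiag,
    Fin.sum_univ_four, Finset.subset_univ, and_true]
  refine ⟨by simp, fun l => ?_⟩
  fin_cases l
  exacts [le_rfl, Nat.zero_le _, Nat.zero_le _, Nat.zero_le _]

variable {k : Type*} [Field k] [CharZero k]

/-- No linear form kills `f` if three coefficients of `f` at its extremal exponents of `x` and `y`
satisfy a nondegeneracy condition. -/
theorem eq_zero_of_sum_X_apply_eq_zero {f : MvPolynomial (Fin 4) k} {p q n : ℕ}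
    (hp : ∀ D, p + 1 < D 0 → coeff D f = 0) (hq : ∀ D, q + 1 < D 1 → coeff D f = 0)
    (h0 : coeff (expVec (p + 1) (q + 1) (n + 2) 0) f ≠ 0)
    (hdet : 2 * (n + 2) * coeff (expVec (p + 1) (q + 1) (n + 2) 0) f *
      coeff (expVec (p + 1) (q + 1) n 2) f -
      (n + 1) * coeff (expVec (p + 1) (q + 1) (n + 1) 1) f ^ 2 ≠ 0)
    {c : Fin 4 → k} (hc : diffAction k 4 (∑ i, c i • X i) f = 0) : c = 0 := by
  have key : ∀ D : Fin 4 →₀ ℕ,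
      ∑ i, c i * (coeff (D + Finsupp.single i 1) f * (D i + 1)) = 0 := fun D => by
    rw [← coeff_diffAction_sum_X, hc, coeff_zero]
  -- At the maximal exponents of `x` and `y` the terms in `c 0` and `c 1` drop out. This leaves a
  -- 2×2 system for `c 2`, `c 3` whose determinant is the quantity in `hdet`. Lowering one of these
  -- exponents by one then isolates `c 0` (`k3`) and `c 1` (`k4`).
  have k1 := key (expVec (p + 1) (q + 1) (n + 1) 0)
  have k2 := key (expVec (p + 1) (q + 1) n 1)
  have k3 := key (expVec p (q + 1) (n + 2) 0)
  have k4 := key (expVec (p + 1) q (n + 2) 0)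
  simp only [Fin.sum_univ_four, expVec_add_single_zero, expVec_add_single_one,
    expVec_add_single_two, expVec_add_single_three, expVec_zero, expVec_one, expVec_two,
    expVec_three] at k1 k2 k3 k4
  have hp' : ∀ q u v, coeff (expVec (p + 1 + 1) q u v) f = 0 := fun q u v => hp _ (by simp)
  have hq' : ∀ p u v, coeff (expVec p (q + 1 + 1) u v) f = 0 := fun p u v => hq _ (by simp)
  simp only [hp', hq', Nat.reduceAdd, add_assoc, zero_mul, mul_zero, zero_add] at k1 k2 k3 k4
  push_cast at k1 k2 k3 k4
  have c3 : c 3 = 0 := by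
    refine (mul_eq_zero.mp ?_).resolve_right hdet
    linear_combination (n + 2 : k) * coeff (expVec (p + 1) (q + 1) (n + 2) 0) f * k2 -
      (n + 1 : k) * coeff (expVec (p + 1) (q + 1) (n + 1) 1) f * k1
  have c2 : c 2 = 0 := by
    refine (mul_eq_zero.mp ?_).resolve_right hdet
    linear_combination 2 * coeff (expVec (p + 1) (q + 1) n 2) f * k1 -
      coeff (expVec (p + 1) (q + 1) (n + 1) 1) f * k2
  rw [c2, c3, zero_mul, zero_mul, add_zero, add_zero] at k3 k4
  have c0 := (mul_eq_zero.mp k3).resolve_right (mul_ne_zero h0 (Nat.cast_add_one_ne_zero p))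
  have c1 := (mul_eq_zero.mp k4).resolve_right (mul_ne_zero h0 (Nat.cast_add_one_ne_zero q))
  ext i
  fin_cases i
  exacts [c0, c1, c2, c3]

end FourVariables

/-! ### Counting constrained monomials and the sufficiency inequality. -/

section Count

theorem card_g1MP_eq_sum {a b d : ℕ} (ha : 0 < a) (hb : 0 < b) :
    (g1MP a b d).card = ∑ p ∈ Finset.range a, ∑ q ∈ Finset.range b, (d + 1 - (p + q)) := by
  rw [← Finset.sum_product', ← Finset.sum_congr rfl
    fun (x : ℕ × ℕ) _ => Finset.card_range (d + 1 - (x.1 + x.2)), ← Finset.card_sigma]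
  refine Finset.card_nbij' (fun D => ⟨(D 0, D 1), D 2⟩)
    (fun x => expVec x.1.1 x.1.2 x.2 (d - x.1.1 - x.1.2 - x.2)) ?_ ?_ ?_ ?_
  · intro D hD
    obtain ⟨h1, h2, h3⟩ := mem_g1MP.mp hD
    simp only [Finset.coe_sigma, Set.mem_sigma_iff, Finset.mem_coe, Finset.mem_product,
      Finset.mem_range]
    omega
  · rintro ⟨⟨p, q⟩, u⟩ hx
    simp only [Finset.coe_sigma, Set.mem_sigma_iff, Finset.mem_coe, Finset.mem_product,
      Finset.mem_range] at hx
    refine mem_g1MP.mpr ?_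
    simp only [expVec_zero, expVec_one, expVec_two, expVec_three]
    omega
  · intro D hD
    obtain ⟨h1, -, -⟩ := mem_g1MP.mp hD
    have h2 : d - D 0 - D 1 - D 2 = D 3 := by omega
    simp only [h2, expVec_eta]
  · intro x _
    rfl

/-- The bound on `d` ensures that no natural subtraction `d + 1 - (p + q)` truncates, so the double
sum is an arithmetic one. The factor `2` avoids a division. -/
theorem two_mul_card_g1MP {a b d : ℕ} (ha : 0 < a) (hb : 0 < b) (hd : a + b ≤ d + 3) :
    (2 * (g1MP a b d).card : ℤ) = a * b * (2 * d + 4 - a - b) := by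
  have inner : ∀ p n : ℕ, p + n ≤ d + 2 →
      (2 * ((∑ q ∈ Finset.range n, (d + 1 - (p + q)) : ℕ) : ℤ)) = n * (2 * d + 3 - 2 * p - n) := by
    intro p n
    induction n with
    | zero => intro _; simp
    | succ n ih =>
      intro hn
      rw [Finset.sum_range_succ, Nat.cast_add, mul_add, ih (by omega), Nat.cast_sub (by omega)]
      push_cast
      ring
  have outer : ∀ m : ℕ, m + b ≤ d + 3 →
      (2 * ((∑ p ∈ Finset.range m, ∑ q ∈ Finset.range b, (d + 1 - (p + q)) : ℕ) : ℤ)) =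
        m * b * (2 * d + 4 - m - b) := by
    intro m
    induction m with
    | zero => intro _; simp
    | succ m ih =>
      intro hm
      rw [Finset.sum_range_succ, Nat.cast_add, mul_add, ih (by omega), inner m b (by omega)]
      push_cast
      ring
  rw [card_g1MP_eq_sum ha hb]
  exact outer a hd

theorem add_le_mul_of_two_le {a b : ℕ} (ha : 2 ≤ a) (hb : 2 ≤ b) : a + b ≤ a * b := by
  nlinarith

theorem four_le_mul {a b : ℕ} (ha : 2 ≤ a) (hb : 2 ≤ b) : 4 ≤ a * b := by
  nlinarith

theorem g1Sufficient_iff {a b i s : ℕ} (ha : 2 ≤ a) (hb : 2 ≤ b) (hi : a * b + 1 ≤ i) :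
    G1Sufficient a b i s ↔ (2 * i - a - b + 10 : ℤ) ≤ s * (2 * a * b - a - b - 2) := by
  have hab := add_le_mul_of_two_le ha hb
  have hab4 := four_le_mul ha hb
  have h1 : G1Sufficient a b i s ↔
      (g1MP a b (i + 3)).card ≤ (g1MP a b (g1J a b i - (i + 3))).card * s := by
    rw [G1Sufficient, Fintype.card_prod, Fintype.card_coe, Fintype.card_coe, Fintype.card_fin]
    rfl
  have h2 : g1J a b i - (i + 3) = a * b - 3 := by
    rw [g1J]
    omega
  rw [h1, h2]
  have e1 := two_mul_card_g1MP (a := a) (b := b) (d := i + 3) (by omega) (by omega) (by omega)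
  have e2 := two_mul_card_g1MP (a := a) (b := b) (d := a * b - 3) (by omega) (by omega) (by omega)
  rw [Nat.cast_sub (by omega)] at e2
  push_cast at e1 e2
  -- Both doubled counts carry the factor `ab`; cancelling it leaves the linear inequality.
  have hpos : (0 : ℤ) < a * b := by exact_mod_cast (by omega : 0 < a * b)
  rw [← mul_le_mul_iff_right₀ hpos]
  zify
  constructor <;> intro h <;> nlinarith

theorem le_card_g1MP {a b i : ℕ} (ha : 2 ≤ a) (hb : 2 ≤ b) (hi : a * b + 1 ≤ i) :
    2 * i + 10 ≤ (g1MP a b (g1J a b i)).card + a + b := by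
  have hab := add_le_mul_of_two_le ha hb
  have hab4 := four_le_mul ha hb
  have e := two_mul_card_g1MP (a := a) (b := b) (d := g1J a b i) (by omega) (by omega)
    (by rw [g1J]; omega)
  rw [g1J] at e ⊢
  zify at *
  have h : (0 : ℤ) ≤ (a * b - 4) * (2 * (i + a * b) + 4 - a - b) :=
    mul_nonneg (by linarith) (by linarith)
  linarith

/-- The least `h_ℰ`-sufficient `s` is a ceiling. -/
theorem ceil_le_iff_g1Sufficient {a b i s : ℕ} (ha : 2 ≤ a) (hb : 2 ≤ b) (hi : a * b + 1 ≤ i) :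
    ⌈(2 * i - a - b + 10 : ℚ) / (2 * a * b - a - b - 2)⌉₊ ≤ s ↔ G1Sufficient a b i s := by
  have hD : (0 : ℚ) < 2 * a * b - a - b - 2 := by
    have hab := add_le_mul_of_two_le ha hb
    have hab4 := four_le_mul ha hb
    qify at hab hab4
    linarith
  rw [Nat.ceil_le, div_le_iff₀ hD, g1Sufficient_iff ha hb hi]
  exact_mod_cast Iff.rfl

end Count

/-! ### The type of a general member. -/

section FamilyType

variable {k : Type*} [Field k]

theorem G1HasType.unique {a b i s t t' : ℕ} (h : G1HasType k a b i s t)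
    (h' : G1HasType k a b i s t') : t = t' := by
  obtain ⟨z, hz, hz'⟩ := ForGeneral.exists_and h h'
  exact hz.type_eq.symm.trans hz'.type_eq

/-- The explicit open conditions: the first two exclude linear annihilators of `f_l`, `hg` makes
`x^j` occur in `g`, and `hminor` gives `ℰ` its largest possible dimension. -/
theorem isLevelAlgebra_g1Ideal [CharZero k] {p q n s a b i m : ℕ} (ha : a = p + 2) (hb : b = q + 2)
    (hn : g1J a b i = p + 1 + (q + 1) + (n + 2)) (l : Fin s)
    (h0 : expVec (p + 1) (q + 1) (n + 2) 0 ∈ g1MP a b (g1J a b i))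
    (h1 : expVec (p + 1) (q + 1) (n + 1) 1 ∈ g1MP a b (g1J a b i))
    (h2 : expVec (p + 1) (q + 1) n 2 ∈ g1MP a b (g1J a b i))
    (hm : m = min s (g1MP a b (g1J a b i)).card)
    (e : Fin m → Fin s) (e' : Fin m → g1MP a b (g1J a b i)) (z : G1Param a b i s → k)
    (hz0 : z (Sum.inl (l, ⟨_, h0⟩)) ≠ 0)
    (hdet : 2 * (n + 2) * z (Sum.inl (l, ⟨_, h0⟩)) * z (Sum.inl (l, ⟨_, h2⟩)) -
      (n + 1) * z (Sum.inl (l, ⟨_, h1⟩)) ^ 2 ≠ 0)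
    (hg : z (Sum.inr (0, ⟨_, expVec_mem_g1MQ _⟩)) ≠ 0)
    (hminor : (Matrix.of fun x y => z (Sum.inl (e x, e' y))).det ≠ 0) :
    IsLevelAlgebra (g1Ideal a b i s z) (g1J a b i) (1 + m) := by
  have hx : expVec (g1J a b i) 0 0 0 ∉ g1MP a b (g1J a b i) := by
    rw [mem_g1MP, expVec_zero]
    omega
  have hfr := finrank_spanForms_sup (fun p => z (Sum.inl p)) (fun p => z (Sum.inr p)) hx
    (expVec_mem_g1MQ _) hg
  rw [le_antisymm (hm ▸ finrank_spanForms_le fun p => z (Sum.inl p))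
    (le_finrank_spanForms _ e e' hminor), add_comm] at hfr
  rw [← hfr]
  refine isLevelAlgebra_annIdeal (sup_le
    (spanForms_le_homogeneousSubmodule _ fun D hD => degree_eq_of_mem_constrained hD)
    (spanForms_le_homogeneousSubmodule _ fun D hD => degree_eq_of_mem_constrained hD)) ?_ ?_
  · intro hbot
    rw [hbot, finrank_bot] at hfr
    omega
  · intro F hF hFW
    obtain ⟨c, rfl⟩ := exists_eq_sum_X hF
    let C : Fin s × g1MP a b (g1J a b i) → k := fun x => z (Sum.inl x)
    have hCF := mem_annIdeal.mp hFW _ (Submodule.mem_sup_left (form_mem_spanForms C l))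
    have hc : c = 0 := by
      refine eq_zero_of_sum_X_apply_eq_zero (p := p) (q := q) (n := n) ?_ ?_ ?_ ?_ hCF
      · intro D hD
        refine coeff_form_of_notMem C l fun hD' => ?_
        have := (mem_g1MP.mp hD').2.1
        omega
      · intro D hD
        refine coeff_form_of_notMem C l fun hD' => ?_
        have := (mem_g1MP.mp hD').2.2
        omega
      · rwa [coeff_form C l h0]
      · rwa [coeff_form C l h0, coeff_form C l h1, coeff_form C l h2]
    simp [hc]

variable [CharZero k]

theorem g1HasType {a b i s : ℕ} (ha : 2 ≤ a) (hb : 2 ≤ b) (hi : a * b + 1 ≤ i) (hs : 0 < s) :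
    G1HasType k a b i s (1 + min s (g1MP a b (g1J a b i)).card) := by
  obtain ⟨p, hp⟩ : ∃ p, a = p + 2 := ⟨a - 2, by omega⟩
  obtain ⟨q, hq⟩ : ∃ q, b = q + 2 := ⟨b - 2, by omega⟩
  obtain ⟨n, hn⟩ : ∃ n, g1J a b i = p + 1 + (q + 1) + (n + 2) := by
    have hab := add_le_mul_of_two_le ha hb
    have hab4 := four_le_mul ha hb
    exact ⟨g1J a b i - (p + q + 4), by rw [g1J]; omega⟩
  have hM : ∀ u v, u + v = n + 2 → expVec (p + 1) (q + 1) u v ∈ g1MP a b (g1J a b i) := by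
    intro u v huv
    rw [mem_g1MP, expVec_zero, expVec_one, expVec_two, expVec_three]
    omega
  have h0 := hM (n + 2) 0 rfl
  have h1 := hM (n + 1) 1 rfl
  have h2 := hM n 2 rfl
  set M := g1MP a b (g1J a b i)
  set m := min s M.card with hm
  set l : Fin s := ⟨0, hs⟩
  let e : Fin m → Fin s := Fin.castLE (min_le_left _ _)
  let e' : Fin m → M := fun x => M.equivFin.symm (Fin.castLE (min_le_right _ _) x)
  let c (D : M) : MvPolynomial (G1Param a b i s) k := X (Sum.inl (l, D))
  let P : MvPolynomial (G1Param a b i s) k := c ⟨_, h0⟩ *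
    (2 * ((n : MvPolynomial (G1Param a b i s) k) + 2) * c ⟨_, h0⟩ * c ⟨_, h2⟩ -
      ((n : MvPolynomial (G1Param a b i s) k) + 1) * c ⟨_, h1⟩ ^ 2) *
    X (Sum.inr (0, ⟨_, expVec_mem_g1MQ _⟩)) *
    (Matrix.of fun x y => (X (Sum.inl (e x, e' y)) : MvPolynomial (G1Param a b i s) k)).det
  have hP : P ≠ 0 := by
    refine mul_ne_zero (mul_ne_zero (mul_ne_zero (X_ne_zero _) ?_) (X_ne_zero _))
      (det_X_ne_zero (fun x : Fin m × Fin m => (Sum.inl (e x.1, e' x.2) : G1Param a b i s)) ?_)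
    · intro h
      classical
      -- With the middle coefficient `0` and the outer two `1`, the determinant becomes `2(n + 2)`,
      -- nonzero in characteristic `0`.
      have h3 := congrArg (eval (Sum.elim (fun x => if x.2 = ⟨_, h1⟩ then 0 else 1)
        fun _ => 0 : G1Param a b i s → k)) h
      have h01 : expVec (p + 1) (q + 1) (n + 2) 0 ≠ expVec (p + 1) (q + 1) (n + 1) 1 :=
        fun h => by simpa using DFunLike.congr_fun h 3
      have h21 : expVec (p + 1) (q + 1) n 2 ≠ expVec (p + 1) (q + 1) (n + 1) 1 :=
        fun h => by simpa using DFunLike.congr_fun h 3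
      simp [c, h01, h21] at h3
      norm_cast at h3
    · rintro ⟨x, y⟩ ⟨x', y'⟩ h
      simp only [Sum.inl.injEq, Prod.mk.injEq] at h
      exact Prod.ext (Fin.castLE_injective _ h.1)
        (Fin.castLE_injective _ (M.equivFin.symm.injective h.2))
  refine forGeneral_of_ne_zero P hP fun z hz => ?_
  simp only [P, c, map_mul, map_sub, map_pow, map_add, map_natCast, map_ofNat, map_one, eval_X,
    RingHom.map_det] at hz
  obtain ⟨⟨⟨hz0, hdet⟩, hg⟩, hminor⟩ :=
    ((by simpa only [mul_ne_zero_iff] using hz) : ((_ ∧ _) ∧ _) ∧ _)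
  refine isLevelAlgebra_g1Ideal hp hq hn l h0 h1 h2 hm e e' z hz0 hdet hg ?_
  convert hminor
  ext x y
  simp

theorem g1HasType_iff {a b i s t : ℕ} (ha : 2 ≤ a) (hb : 2 ≤ b) (hi : a * b + 1 ≤ i)
    (hs : 0 < s) : G1HasType k a b i s t ↔ t = 1 + min s (g1MP a b (g1J a b i)).card :=
  ⟨fun h => h.unique (g1HasType ha hb hi hs), fun h => h ▸ g1HasType ha hb hi hs⟩

end FamilyType

/-! ### The least type and the small cases. -/

section Least

/-- Since `i ≥ ab + 1`, the left side of the sufficiency inequality is at least `2ab - a - b + 12`,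
which already rules out `s = 1`. -/
theorem two_le_of_g1Sufficient {a b i s : ℕ} (ha : 2 ≤ a) (hb : 2 ≤ b) (hi : a * b + 1 ≤ i)
    (h : G1Sufficient a b i s) : 2 ≤ s := by
  rw [g1Sufficient_iff ha hb hi] at h
  have hab := add_le_mul_of_two_le ha hb
  by_contra! hs
  zify at hab hi
  interval_cases s <;> push_cast at h <;> linarith

/-- The number `m_P(j)` is itself a sufficient value of `s`, so it bounds every lower bound of the
sufficient values. -/
theorem G1Sufficient.le_card {a b i s : ℕ} (ha : 2 ≤ a) (hb : 2 ≤ b) (hi : a * b + 1 ≤ i)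
    (h : ∀ s', G1Sufficient a b i s' → s ≤ s') : s ≤ (g1MP a b (g1J a b i)).card := by
  refine h _ ((g1Sufficient_iff ha hb hi).mpr ?_)
  have h1 := le_card_g1MP ha hb hi
  have hab := add_le_mul_of_two_le ha hb
  have hab4 := four_le_mul ha hb
  zify at *
  have h2 : (0 : ℤ) ≤ (g1MP a b (g1J a b i)).card * (2 * a * b - a - b - 3) :=
    mul_nonneg (by positivity) (by linarith)
  linarith

variable (k : Type*) [Field k] [CharZero k]

theorem exists_g1HasType {a b i s : ℕ} (h : G1Admissible a b i s) :
    (∃ t, G1HasType k a b i s t) ∧ ∀ t, G1HasType k a b i s t → 3 ≤ t := by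
  have hb := h.two_le.trans h.le
  refine ⟨⟨_, g1HasType h.two_le hb h.le_i h.s_pos⟩, fun t ht => ?_⟩
  rw [g1HasType_iff h.two_le hb h.le_i h.s_pos] at ht
  have h1 := two_le_of_g1Sufficient h.two_le hb h.le_i h.sufficient
  have h2 := le_card_g1MP h.two_le hb h.le_i
  have hab := add_le_mul_of_two_le h.two_le hb
  have h3 := h.le_i
  omega

/-- Letting `i'` range over all values `≥ i` serves both minimality claims: `i' = i` for fixed `i`,
and `i = ab + 1` when `i` varies. -/
theorem isLeast_g1HasType {a b i s₀ : ℕ} (ha : 2 ≤ a) (hab : a ≤ b) (hi : a * b + 1 ≤ i)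
    (hs₀ : ∀ s, s₀ ≤ s ↔ G1Sufficient a b i s) :
    G1Admissible a b i s₀ ∧ G1HasType k a b i s₀ (1 + s₀) ∧
      ∀ i' s t, i ≤ i' → G1Admissible a b i' s → G1HasType k a b i' s t → 1 + s₀ ≤ t := by
  have hb := ha.trans hab
  have hsuff := (hs₀ s₀).mp le_rfl
  have h2 := two_le_of_g1Sufficient ha hb hi hsuff
  have hcard : s₀ ≤ (g1MP a b (g1J a b i)).card :=
    G1Sufficient.le_card ha hb hi fun s hs => (hs₀ s).mpr hs
  refine ⟨⟨ha, hab, hi, by omega, hsuff⟩, ?_, ?_⟩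
  · rw [g1HasType_iff ha hb hi (by omega), min_eq_left hcard]
  · intro i' s t hii' hadm ht
    -- Raising `i` only increases the left side of the sufficiency inequality, so what suffices for
    -- `i'` suffices for `i`.
    have hmono : ∀ s', G1Sufficient a b i' s' → s₀ ≤ s' := fun s' hs' => by
      rw [hs₀, g1Sufficient_iff ha hb hi]
      rw [g1Sufficient_iff ha hb (hi.trans hii')] at hs'
      zify at hii'
      linarith
    rw [g1HasType_iff ha hb hadm.le_i hadm.s_pos] at ht
    rw [ht]
    exact Nat.add_le_add_left (le_min (hmono s hadm.sufficient)
      (G1Sufficient.le_card ha hb hadm.le_i hmono)) 1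

theorem ceil_le_iff {a b s : ℕ} (ha : 2 ≤ a) (hb : 2 ≤ b) :
    ⌈(2 * a * b - a - b + 12 : ℚ) / (2 * a * b - a - b - 2)⌉₊ ≤ s ↔
      G1Sufficient a b (a * b + 1) s := by
  rw [← ceil_le_iff_g1Sufficient ha hb le_rfl]
  have h : (2 * (a * b + 1 : ℕ) - a - b + 10 : ℚ) = 2 * a * b - a - b + 12 := by
    push_cast
    ring
  rw [h]

/-- For `s = 2` and `i = ab + 1` the inequality reads `2ab - a - b ≥ 16`. -/
theorem g1Sufficient_two_iff {a b : ℕ} (ha : 2 ≤ a) (hab : a ≤ b) :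
    G1Sufficient a b (a * b + 1) 2 ↔ (3 ≤ a ∧ 4 ≤ b) ∨ (2 ≤ a ∧ 6 ≤ b) := by
  rw [g1Sufficient_iff ha (ha.trans hab) le_rfl]
  push_cast
  constructor
  · intro h
    by_contra! hcon
    have h5 : b ≤ 5 := by omega
    have h3 : a ≤ 3 := by omega
    interval_cases a <;> interval_cases b <;> omega
  · zify
    rintro (⟨h1, h2⟩ | ⟨h1, h2⟩) <;> nlinarith

/-- Type `4` means that `3` suffices but `2` does not, that is, `9 ≤ 2ab - a - b < 16`. -/
theorem g1HasType_four_iff (a b : ℕ) :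
    (2 ≤ a ∧ a ≤ b ∧ G1HasType k a b (a * b + 1)
      ⌈(2 * a * b - a - b + 12 : ℚ) / (2 * a * b - a - b - 2)⌉₊ 4) ↔
      (a = 2 ∧ b = 4) ∨ (a = 2 ∧ b = 5) ∨ (a = 3 ∧ b = 3) := by
  have main : 2 ≤ a → a ≤ b → (G1HasType k a b (a * b + 1)
      ⌈(2 * a * b - a - b + 12 : ℚ) / (2 * a * b - a - b - 2)⌉₊ 4 ↔
      G1Sufficient a b (a * b + 1) 3 ∧ ¬ ((3 ≤ a ∧ 4 ≤ b) ∨ (2 ≤ a ∧ 6 ≤ b))) := by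
    intro ha hab
    have h1 := (isLeast_g1HasType k ha hab le_rfl fun s => ceil_le_iff ha (ha.trans hab)).2.1
    rw [← g1Sufficient_two_iff ha hab, ← ceil_le_iff ha (ha.trans hab),
      ← ceil_le_iff ha (ha.trans hab)]
    constructor
    · intro h
      have := h1.unique h
      omega
    · intro h
      have h4 : 1 + ⌈(2 * a * b - a - b + 12 : ℚ) / (2 * a * b - a - b - 2)⌉₊ = 4 := by omega
      rwa [h4] at h1
  constructor
  · rintro ⟨ha, hab, h⟩
    obtain ⟨h3, hcon⟩ := (main ha hab).mp h
    rw [g1Sufficient_iff ha (ha.trans hab) le_rfl] at h3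
    push_cast at h3
    have hb5 : b ≤ 5 := by omega
    have ha3 : a ≤ 3 := by omega
    interval_cases a <;> interval_cases b <;> omega
  · rintro (⟨rfl, rfl⟩ | ⟨rfl, rfl⟩ | ⟨rfl, rfl⟩) <;>
      refine ⟨by norm_num, by norm_num, (main (by norm_num) (by norm_num)).mpr
        ⟨(g1Sufficient_iff (by norm_num) (by norm_num) le_rfl).mpr (by norm_num), by norm_num⟩⟩

end Least

end LevelAlg

/-! ### The main theorem. -/

theorem mainTheorem10 (k : Type*) [Field k] [IsAlgClosed k] [CharZero k] :
    -- (i) the least type for fixed `a`, `b`, `i`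
    (∀ a b i s₀ : ℕ, 2 ≤ a → a ≤ b → a * b + 1 ≤ i →
      s₀ = ⌈(2 * i - a - b + 10 : ℚ) / (2 * a * b - a - b - 2)⌉₊ →
        LevelAlg.G1Admissible a b i s₀ ∧ LevelAlg.G1HasType k a b i s₀ (1 + s₀) ∧
        IsLeast {t | ∃ s, LevelAlg.G1Admissible a b i s ∧ LevelAlg.G1HasType k a b i s t}
          (1 + s₀)) ∧
    -- (ii) the least type for fixed `a`, `b`, and when it equals `3`
    (∀ a b s₀ : ℕ, 2 ≤ a → a ≤ b →
      s₀ = ⌈(2 * a * b - a - b + 12 : ℚ) / (2 * a * b - a - b - 2)⌉₊ →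
        LevelAlg.G1Admissible a b (a * b + 1) s₀ ∧
        LevelAlg.G1HasType k a b (a * b + 1) s₀ (1 + s₀) ∧
        IsLeast {t | ∃ i s, LevelAlg.G1Admissible a b i s ∧ LevelAlg.G1HasType k a b i s t}
          (1 + s₀) ∧
        (LevelAlg.G1HasType k a b (a * b + 1) s₀ 3 ↔ (3 ≤ a ∧ 4 ≤ b) ∨ (2 ≤ a ∧ 6 ≤ b))) ∧
    -- (ii), continued: the minimal pairs `(a, b)` for which that least type is `4`
    {p : ℕ × ℕ | Minimal (fun q : ℕ × ℕ => 2 ≤ q.1 ∧ q.1 ≤ q.2 ∧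
        LevelAlg.G1HasType k q.1 q.2 (q.1 * q.2 + 1)
          ⌈(2 * q.1 * q.2 - q.1 - q.2 + 12 : ℚ) / (2 * q.1 * q.2 - q.1 - q.2 - 2)⌉₊ 4) p} =
      {(2, 4), (3, 3)} ∧
    -- (iii) every member of the family has type at least `3`
    (∀ a b i s : ℕ, LevelAlg.G1Admissible a b i s →
      (∃ t, LevelAlg.G1HasType k a b i s t) ∧
      ∀ t, LevelAlg.G1HasType k a b i s t → 3 ≤ t) := by
  refine ⟨?_, ?_, ?_, fun a b i s h => LevelAlg.exists_g1HasType k h⟩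
  · rintro a b i s₀ ha hab hi rfl
    obtain ⟨h1, h2, h3⟩ := LevelAlg.isLeast_g1HasType k ha hab hi
      fun s => LevelAlg.ceil_le_iff_g1Sufficient ha (ha.trans hab) hi
    exact ⟨h1, h2, ⟨_, h1, h2⟩, fun t ⟨s, hs, ht⟩ => h3 i s t le_rfl hs ht⟩
  · rintro a b s₀ ha hab rfl
    have hb := ha.trans hab
    obtain ⟨h1, h2, h3⟩ := LevelAlg.isLeast_g1HasType k ha hab le_rfl
      fun s => LevelAlg.ceil_le_iff ha hb
    refine ⟨h1, h2, ⟨⟨_, _, h1, h2⟩, fun t ⟨i, s, hs, ht⟩ => h3 i s t hs.le_i hs ht⟩, ?_⟩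
    rw [← LevelAlg.g1Sufficient_two_iff ha hab, ← LevelAlg.ceil_le_iff ha hb]
    have h4 := LevelAlg.two_le_of_g1Sufficient ha hb le_rfl h1.sufficient
    constructor
    · intro h
      have := h2.unique h
      omega
    · intro h
      rwa [le_antisymm h h4] at h2 ⊢
  · ext ⟨a, b⟩
    simp only [LevelAlg.g1HasType_four_iff, Set.mem_ofPred_eq, Set.mem_insert_iff,
      Set.mem_singleton_iff, Prod.mk.injEq]
    constructor
    · rintro ⟨h | ⟨rfl, rfl⟩ | h, hmin⟩
      · exact Or.inl h
      -- The pair `(2, 5)` also has type `4` but lies strictly above `(2, 4)`.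
      · have := (hmin (y := (2, 4)) (by simp) (by simp)).2
        simp at this
      · exact Or.inr h
    · rintro (⟨rfl, rfl⟩ | ⟨rfl, rfl⟩) <;> refine ⟨by simp, ?_⟩ <;> rintro ⟨c, d⟩ hcd hle <;>
        simp only [Prod.mk_le_mk] at hle ⊢ <;> omega
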